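/- Let $d_x,d_u\ge 1$ be the state and input dimensions, let $R_x\in\mathbb R^{d_x\times d_x}$ be symmetric with $R_x\succeq I$, and let $R_u=I\in\mathbb R^{d_u\times d_u}$. Here $\preceq$ is the Loewner order, $\|\cdot\|$ is the spectral norm, and a real square matrix is called stable if its spectral radius is less than $1$. A pair $(A,B)\in\mathbb R^{d_x\times d_x}\times\mathbb R^{d_x\times d_u}$ is stabilizable if $A+BK$ is stable for some $K\in\mathbb R^{d_u\times d_x}$. For stabilizable $(A,B)$, let $P_\infty(A,B)$ be the unique positive semidefinite solution of the discrete algebraic Riccati equation $$P=A^\top PA-A^\top PB(R_u+B^\top PB)^{-1}B^\top PA+R_x,$$ and let $K_\infty(A,B)=-(R_u+B^\top P_\infty(A,B)B)^{-1}B^\top P_\infty(A,B)A$. For stable $X$, let $\mathsf{dlyap}[X]$ be the unique positive semidefinite solution $P$ of $P-X^\top PX=I$, and let $\|X\|_{\mathcal H_\infty}=\sup_{z\in\mathbb C,\,|z|=1}\|(zI-X)^{-1}\|$. **Theorem.** Let $(A_\star,B_\star)$ be stabilizable, and put $P_\star=P_\infty(A_\star,B_\star)$, $K_\star=K_\infty(A_\star,B_\star)$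 and $A_{\mathrm{cl},\star}=A_\star+B_\star K_\star$. Let $(\widehat A,\widehat B)$ be a pair of matrices with $$\max\{\|\widehat A-A_\star\|,\|\widehat B-B_\star\|\}\le\frac1{54\,\|P_\star\|^5}.$$ Then $(\widehat A,\widehat B)$ is stabilizable, and, with $A_{\mathrm{cl},\widehat\star}=A_\star+B_\star K_\infty(\widehat A,\widehat B)$, the matrices $A_{\mathrm{cl},\star}$ and $A_{\mathrm{cl},\widehat\star}$ are stable. Moreover: 1. $I\preceq\mathsf{dlyap}[A_{\mathrm{cl},\star}]\preceq P_\star$. 2. $\|A_{\mathrm{cl},\widehat\star}\|_{\mathcal H_\infty}\le 2\|A_{\mathrm{cl},\star}\|_{\mathcal H_\infty}\le 4\,\|\mathsf{dlyap}[A_{\mathrm{cl},\star}]\|^{3/2}\le 4\,\|P_\star\|^{3/2}$. 3. $A_{\mathrm{cl},\widehat\star}^\top\,\mathsf{dlyap}[A_{\mathrm{cl},\star}]\,A_{\mathrm{cl},\widehat\star}\preceq\bigl(1-\tfrac12\|\mathsf{dlyap}[A_{\mathrm{cl},\star}]\|^{-1}\bigr)\mathsf{dlyap}[A_{\mathrm{cl},\star}]\preceq\bigl(1-\tfrac12\|P_\star\|^{-1}\bigr)\mathsf{dlyap}[A_{\mathrm{cl},\star}]$.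 -/

import Mathlib

open scoped Matrix Matrix.Norms.L2Operator MatrixOrder

noncomputable section

namespace LQR

/- Throughout, the norm of a matrix is the spectral norm (the operator norm between Euclidean
spaces), and `X ≤ Y` is the Loewner order: `Y - X` is symmetric positive semidefinite. -/

variable {n m : ℕ}

/-- The complexification of a real square matrix. -/
def toComplex (X : Matrix (Fin n) (Fin n) ℝ) : Matrix (Fin n) (Fin n) ℂ :=
  X.map ((↑) : ℝ → ℂ)

/-- A real matrix is stable if its spectral radius (the largest modulus of a complex eigenvalue)
is less than one. -/
def Stable (X : Matrix (Fin n) (Fin n) ℝ) : Prop :=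
  spectralRadius ℂ (toComplex X) < 1

/-- `(A, B)` is stabilizable if some static feedback `u = K x` makes the closed loop stable. -/
def Stabilizable (A : Matrix (Fin n) (Fin n) ℝ) (B : Matrix (Fin n) (Fin m) ℝ) : Prop :=
  ∃ K : Matrix (Fin m) (Fin n) ℝ, Stable (A + B * K)

/-- `P` is a positive semidefinite solution of the discrete algebraic Riccati equation. -/
def IsDARESolution (Rx : Matrix (Fin n) (Fin n) ℝ) (Ru : Matrix (Fin m) (Fin m) ℝ)
    (A : Matrix (Fin n) (Fin n) ℝ) (B : Matrix (Fin n) (Fin m) ℝ)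
    (P : Matrix (Fin n) (Fin n) ℝ) : Prop :=
  P.PosSemidef ∧
    P = Aᵀ * P * A - Aᵀ * P * B * (Ru + Bᵀ * P * B)⁻¹ * Bᵀ * P * A + Rx

open Classical in
/-- `P_∞(A, B)`: the positive semidefinite solution of the Riccati equation. It exists and is
unique if `(A, B)` is stabilizable and `Rx`, `Ru` are positive definite. -/
def Pinf (Rx : Matrix (Fin n) (Fin n) ℝ) (Ru : Matrix (Fin m) (Fin m) ℝ)
    (A : Matrix (Fin n) (Fin n) ℝ) (B : Matrix (Fin n) (Fin m) ℝ) :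
    Matrix (Fin n) (Fin n) ℝ :=
  if h : ∃ P, IsDARESolution Rx Ru A B P then h.choose else 0

/-- `K_∞(A, B)`: the optimal infinite-horizon controller. -/
def Kinf (Rx : Matrix (Fin n) (Fin n) ℝ) (Ru : Matrix (Fin m) (Fin m) ℝ)
    (A : Matrix (Fin n) (Fin n) ℝ) (B : Matrix (Fin n) (Fin m) ℝ) :
    Matrix (Fin m) (Fin n) ℝ :=
  -((Ru + Bᵀ * Pinf Rx Ru A B * B)⁻¹ * Bᵀ * Pinf Rx Ru A B * A)

open Classical in
/-- `dlyap(X, Y)` for `Y` positive semidefinite: the positive semidefinite solution `P` of the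
discrete Lyapunov equation `P - Xᵀ P X = Y`. It exists and is unique if `X` is stable. -/
def dlyap (X Y : Matrix (Fin n) (Fin n) ℝ) : Matrix (Fin n) (Fin n) ℝ :=
  if h : ∃ P : Matrix (Fin n) (Fin n) ℝ, P.PosSemidef ∧ P - Xᵀ * P * X = Y
  then h.choose else 0

/-- The `H_∞` norm of a stable matrix: the supremum of `‖(z I - X)⁻¹‖` over the complex unit
circle. -/
def HinfNorm (X : Matrix (Fin n) (Fin n) ℝ) : ℝ :=
  ⨆ z : Metric.sphere (0 : ℂ) 1,
    ‖((z : ℂ) • (1 : Matrix (Fin n) (Fin n) ℂ) - toComplex X)⁻¹‖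

/-- `C_safe(A, B) = 54 ‖P_∞(A, B)‖⁵`. -/
def Csafe (Rx : Matrix (Fin n) (Fin n) ℝ) (Ru : Matrix (Fin m) (Fin m) ℝ)
    (A : Matrix (Fin n) (Fin n) ℝ) (B : Matrix (Fin n) (Fin m) ℝ) : ℝ :=
  54 * ‖Pinf Rx Ru A B‖ ^ 5

end LQR

end

/-
Completing the square, the Riccati operator is `P ↦ min_K policyCost P K`, attained at the gain
`K(P)`. The optimal gain of one system is therefore admissible for the other, and its closed loop
keeps the old value matrix as a Lyapunov function, up to a small relative loss `η` of the stage
cost. This gives `(1 - η) P' ≤ P`, and the same inequality with the systems exchanged, so `P` and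
`P'` are close. The two gains solve linear equations whose difference yields a quadratic energy
inequality for `B (K' - K)`; it uses only `Ru + Bᵀ P B ≥ 1 + Bᵀ B`, so neither `‖B‖` nor an inverse
enters the bound `‖B (K' - K)‖ ≤ 1 / (5 s³)`, where `s² ≥ ‖P‖`. Under a perturbation of that size
`D = dlyap[Acl]` remains a Lyapunov function with half of its decay.

For the resolvent `q = (z - X)⁻¹` on the unit circle, substituting `X q = z q - 1` in the Lyapunov
inequality gives `q* q ≤ 2 Re (z D q)`, hence `‖q‖ ≤ 2 ‖D‖`.
-/

open Filter Topology

noncomputable section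

namespace LQR

section Loewner

variable {ι κ : Type*}

lemma isSymm_of_nonneg {S : Matrix ι ι ℝ} (hS : 0 ≤ S) : S.IsSymm :=
  Matrix.isHermitian_iff_isSymm.1 (Matrix.nonneg_iff_posSemidef.1 hS).isHermitian

instance [Finite ι] : OrderClosedTopology (Matrix ι ι ℝ) where
  isClosed_le' := isClosed_le_of_isClosed_nonneg <| by
    have := Fintype.ofFinite ι
    simp only [Matrix.nonneg_iff_posSemidef, Matrix.posSemidef_iff_dotProduct_mulVec,
      Matrix.IsHermitian, Set.ofPred_and, Set.ofPred_forall]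
    exact (isClosed_eq (by fun_prop) continuous_id).inter
      (isClosed_iInter fun v => isClosed_le continuous_const (by fun_prop))

variable [Fintype ι] [Finite κ]

lemma conj_nonneg {S : Matrix ι ι ℝ} (hS : 0 ≤ S) (L : Matrix ι κ ℝ) : 0 ≤ Lᵀ * S * L :=
  ((Matrix.nonneg_iff_posSemidef.1 hS).conjTranspose_mul_mul_same L).nonneg

lemma conj_mono {S T : Matrix ι ι ℝ} (hST : S ≤ T) (L : Matrix ι κ ℝ) :
    Lᵀ * S * L ≤ Lᵀ * T * L := by
  simpa only [Matrix.mul_sub, Matrix.sub_mul, sub_nonneg] using conj_nonneg (sub_nonneg.2 hST) L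

lemma gram_nonneg (L : Matrix ι κ ℝ) : 0 ≤ Lᵀ * L :=
  (Matrix.posSemidef_conjTranspose_mul_self L).nonneg

lemma mul_add_mul_le_gram_add_gram (Y Z : Matrix ι κ ℝ) :
    Yᵀ * Z + Zᵀ * Y ≤ Yᵀ * Y + Zᵀ * Z := by
  rw [← sub_nonneg]
  convert gram_nonneg (Y - Z) using 1
  simp only [Matrix.transpose_sub, Matrix.mul_sub, Matrix.sub_mul]
  abel

lemma gram_add_gram_le {μ : Type*} [Fintype μ] {Y a : Matrix ι κ ℝ} {Z b : Matrix μ κ ℝ}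
    (h : Yᵀ * Y + Zᵀ * Z ≤ Yᵀ * a + Zᵀ * b) : Yᵀ * Y + Zᵀ * Z ≤ aᵀ * a + bᵀ * b := by
  have hsymm : Yᵀ * a + Zᵀ * b = aᵀ * Y + bᵀ * Z := by
    have hadd := isSymm_of_nonneg ((add_nonneg (gram_nonneg Y) (gram_nonneg Z)).trans h)
    simpa only [Matrix.transpose_add, Matrix.transpose_mul, Matrix.transpose_transpose]
      using hadd.eq.symm
  refine le_of_add_le_add_left (a := Yᵀ * Y + Zᵀ * Z) ?_
  calc Yᵀ * Y + Zᵀ * Z + (Yᵀ * Y + Zᵀ * Z)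
      ≤ (Yᵀ * a + Zᵀ * b) + (aᵀ * Y + bᵀ * Z) := add_le_add h (h.trans_eq hsymm)
    _ = (Yᵀ * a + aᵀ * Y) + (Zᵀ * b + bᵀ * Z) := add_add_add_comm _ _ _ _
    _ ≤ (Yᵀ * Y + aᵀ * a) + (Zᵀ * Z + bᵀ * b) :=
        add_le_add (mul_add_mul_le_gram_add_gram Y a) (mul_add_mul_le_gram_add_gram Z b)
    _ = Yᵀ * Y + Zᵀ * Z + (aᵀ * a + bᵀ * b) := add_add_add_comm _ _ _ _

end Loewner

section LoewnerNorm

variable {ι κ : Type*} [Fintype ι] [Fintype κ] [DecidableEq ι]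

lemma le_norm_smul_one {T : Matrix ι ι ℝ} (hT : T.IsSymm) : T ≤ ‖T‖ • 1 := by
  rw [← Algebra.algebraMap_eq_smul_one]
  exact le_algebraMap_of_spectrum_le fun x hx =>
    (Real.le_norm_self x).trans (IsometricContinuousFunctionalCalculus.norm_spectrum_le T hx hT)

lemma norm_le_of_neg_le_of_le {T : Matrix ι ι ℝ} {c : ℝ} (hc : 0 ≤ c)
    (hl : -(c • 1) ≤ T) (hu : T ≤ c • 1) : ‖T‖ ≤ c := by
  have hT : IsSelfAdjoint T := by
    simpa using (IsSelfAdjoint.smul (.all c) (.one (Matrix ι ι ℝ))).sub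
      (sub_nonneg.2 hu).isSelfAdjoint
  rw [← neg_smul, ← Algebra.algebraMap_eq_smul_one,
    algebraMap_le_iff_le_spectrum (p := IsSelfAdjoint)] at hl
  rw [← Algebra.algebraMap_eq_smul_one, le_algebraMap_iff_spectrum_le (p := IsSelfAdjoint)] at hu
  simpa only [cfc_id' ℝ T] using
    norm_cfc_le (f := fun x : ℝ => x) (a := T) hc fun x hx => abs_le.2 ⟨hl x hx, hu x hx⟩

lemma norm_le_of_nonneg_of_le_smul_one {S : Matrix ι ι ℝ} {c : ℝ} (hc : 0 ≤ c) (hS : 0 ≤ S)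
    (h : S ≤ c • 1) : ‖S‖ ≤ c :=
  norm_le_of_neg_le_of_le hc ((neg_nonpos.2 (smul_nonneg hc zero_le_one)).trans hS) h

lemma norm_le_norm_of_nonneg_of_le {S T : Matrix ι ι ℝ} (hS : 0 ≤ S) (hST : S ≤ T) :
    ‖S‖ ≤ ‖T‖ :=
  norm_le_of_nonneg_of_le_smul_one (norm_nonneg T) hS
    (hST.trans (le_norm_smul_one (isSymm_of_nonneg (hS.trans hST))))

lemma le_smul_one_of_norm_le {S : Matrix ι ι ℝ} {c : ℝ} (hS : 0 ≤ S) (h : ‖S‖ ≤ c) : S ≤ c • 1 :=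
  (le_norm_smul_one (isSymm_of_nonneg hS)).trans (smul_le_smul_of_nonneg_right h zero_le_one)

lemma sub_le_smul_one_of_one_sub_smul_le {S T : Matrix ι ι ℝ} {η c : ℝ} (hη : 0 ≤ η)
    (hS : 0 ≤ S) (hc : ‖S‖ ≤ c) (h : (1 - η) • S ≤ T) : S - T ≤ (η * c) • 1 := by
  calc S - T ≤ S - (1 - η) • S := sub_le_sub_left h S
    _ = η • S := by module
    _ ≤ η • (c • 1) := smul_le_smul_of_nonneg_left (le_smul_one_of_norm_le hS hc) hη
    _ = (η * c) • 1 := smul_smul _ _ _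

lemma eq_zero_or_one_le_norm {S : Matrix ι ι ℝ} (h : 1 ≤ S) : S = 0 ∨ 1 ≤ ‖S‖ := by
  rcases subsingleton_or_nontrivial (Matrix ι ι ℝ) with _ | _
  · exact .inl (Subsingleton.elim S 0)
  · exact .inr (CStarRing.norm_one.symm.trans_le (norm_le_norm_of_nonneg_of_le zero_le_one h))

lemma norm_gram (S : Matrix κ ι ℝ) : ‖Sᵀ * S‖ = ‖S‖ ^ 2 := by
  rw [← Matrix.conjTranspose_eq_transpose_of_trivial, Matrix.l2_opNorm_conjTranspose_mul_self, sq]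

lemma norm_transpose_mul_mul_le {μ : Type*} [Fintype μ] [DecidableEq κ] [DecidableEq μ]
    (L : Matrix ι κ ℝ) (S : Matrix ι ι ℝ) (M : Matrix ι μ ℝ) : ‖Lᵀ * S * M‖ ≤ ‖L‖ * ‖S‖ * ‖M‖ := by
  calc ‖Lᵀ * S * M‖ ≤ ‖Lᵀ‖ * ‖S‖ * ‖M‖ := (Matrix.l2_opNorm_mul _ _).trans
        (mul_le_mul_of_nonneg_right (Matrix.l2_opNorm_mul _ _) (norm_nonneg M))
    _ = ‖L‖ * ‖S‖ * ‖M‖ := by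
        rw [← Matrix.conjTranspose_eq_transpose_of_trivial, Matrix.l2_opNorm_conjTranspose]

lemma norm_le_iff_gram_le {S : Matrix κ ι ℝ} {c : ℝ} (hc : 0 ≤ c) :
    ‖S‖ ≤ c ↔ Sᵀ * S ≤ c ^ 2 • 1 := by
  rw [← sq_le_sq₀ (norm_nonneg S) hc, ← norm_gram]
  exact ⟨le_smul_one_of_norm_le (gram_nonneg S),
    norm_le_of_nonneg_of_le_smul_one (sq_nonneg c) (gram_nonneg S)⟩

end LoewnerNorm

section Complexification

variable {n : ℕ}

lemma toComplex_eq_mapMatrix (X : Matrix (Fin n) (Fin n) ℝ) :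
    toComplex X = (algebraMap ℝ ℂ).mapMatrix X := rfl

lemma conjTranspose_toComplex (X : Matrix (Fin n) (Fin n) ℝ) : (toComplex X)ᴴ = toComplex Xᵀ := by
  ext; simp [toComplex]

open scoped ComplexOrder in
lemma toComplex_nonneg_iff {S : Matrix (Fin n) (Fin n) ℝ} : 0 ≤ toComplex S ↔ 0 ≤ S := by
  constructor
  · intro h
    rw [Matrix.nonneg_iff_posSemidef, Matrix.posSemidef_iff_dotProduct_mulVec] at h ⊢
    refine ⟨?_, fun v => ?_⟩
    · ext i j
      simpa [toComplex] using congrFun₂ h.1 i j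
    · have := h.2 ((↑) ∘ v)
      have e : star ((↑) ∘ v : Fin n → ℂ) ⬝ᵥ toComplex S *ᵥ ((↑) ∘ v) = ↑(v ⬝ᵥ S *ᵥ v) := by
        simp [toComplex, dotProduct, Matrix.mulVec]
      simpa [e] using this
  · intro h
    obtain ⟨M, rfl⟩ := CStarAlgebra.nonneg_iff_eq_star_mul_self.1 h
    rw [show toComplex (star M * M) = (toComplex M)ᴴ * toComplex M from ?_]
    · exact (Matrix.posSemidef_conjTranspose_mul_self _).nonneg
    · rw [conjTranspose_toComplex]
      exact map_mul (algebraMap ℝ ℂ).mapMatrix _ _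

open scoped ComplexOrder in
lemma norm_toComplex_le_iff {X : Matrix (Fin n) (Fin n) ℝ} {c : ℝ} (hc : 0 ≤ c) :
    ‖toComplex X‖ ≤ c ↔ ‖X‖ ≤ c := by
  have hsub : algebraMap ℝ _ (c ^ 2) - star (toComplex X) * toComplex X =
      toComplex (c ^ 2 • 1 - Xᵀ * X) := by
    rw [Matrix.star_eq_conjTranspose, conjTranspose_toComplex, Algebra.algebraMap_eq_smul_one]
    ext i j
    simp [toComplex, Matrix.mul_apply, Matrix.one_apply, apply_ite]
  rw [norm_le_iff_gram_le hc, ← sub_nonneg (a := c ^ 2 • 1), ← toComplex_nonneg_iff, ← hsub,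
    sub_nonneg, ← CStarAlgebra.norm_le_iff_le_algebraMap _ (sq_nonneg c) (star_mul_self_nonneg _),
    CStarRing.norm_star_mul_self, ← sq, sq_le_sq₀ (norm_nonneg _) hc]

lemma norm_toComplex (X : Matrix (Fin n) (Fin n) ℝ) : ‖toComplex X‖ = ‖X‖ :=
  le_antisymm ((norm_toComplex_le_iff (norm_nonneg X)).2 le_rfl)
    ((norm_toComplex_le_iff (norm_nonneg _)).1 le_rfl)

end Complexification

section BanachAlgebra

variable {𝔸 : Type*} [NormedRing 𝔸] [NormedAlgebra ℂ 𝔸] [CompleteSpace 𝔸] {a : 𝔸}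

lemma summable_norm_pow_of_spectralRadius_lt_one (h : spectralRadius ℂ a < 1) :
    Summable fun k : ℕ => ‖a ^ k‖ := by
  obtain ⟨r, hρr, hr⟩ := ENNReal.lt_iff_exists_nnreal_btwn.1 h
  refine Summable.of_norm_bounded_eventually_nat
    (summable_geometric_of_lt_one r.coe_nonneg (by exact_mod_cast hr)) ?_
  have hlim := spectrum.pow_nnnorm_pow_one_div_tendsto_nhds_spectralRadius a
  filter_upwards [hlim.eventually_lt_const hρr, eventually_ne_atTop 0] with k hk hk0
  have hroot := ENNReal.rpow_le_rpow hk.le k.cast_nonneg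
  rw [← ENNReal.rpow_mul, one_div_mul_cancel (Nat.cast_ne_zero.2 hk0), ENNReal.rpow_one,
    ENNReal.rpow_natCast] at hroot
  rw [norm_norm]
  exact_mod_cast hroot

lemma spectralRadius_lt_one_of_tendsto_pow (h : Tendsto (fun k : ℕ => a ^ k) atTop (𝓝 0)) :
    spectralRadius ℂ a < 1 := by
  have hlim : Tendsto (fun k : ℕ => ‖a ^ (k + 1)‖₊ * ‖(1 : 𝔸)‖₊) atTop (𝓝 0) := by
    simpa using ((tendsto_add_atTop_iff_nat 1).2 h).nnnorm.mul_const ‖(1 : 𝔸)‖₊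
  obtain ⟨k, hk⟩ := (hlim.eventually_lt_const one_pos).exists
  refine (spectrum.spectralRadius_le_pow_nnnorm_pow_one_div ℂ a k).trans_lt ?_
  rw [← ENNReal.mul_rpow_of_nonneg _ _ (by positivity)]
  exact ENNReal.rpow_lt_one (by exact_mod_cast hk) (by positivity)

end BanachAlgebra

section Stability

variable {n : ℕ} {X S T Y : Matrix (Fin n) (Fin n) ℝ}

lemma toComplex_pow (X : Matrix (Fin n) (Fin n) ℝ) (k : ℕ) :
    toComplex (X ^ k) = toComplex X ^ k :=
  map_pow (algebraMap ℝ ℂ).mapMatrix X k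

lemma Stable.summable_norm_pow (hX : Stable X) : Summable fun k : ℕ => ‖X ^ k‖ := by
  simpa only [← toComplex_pow, norm_toComplex] using summable_norm_pow_of_spectralRadius_lt_one hX

lemma Stable.tendsto_pow (hX : Stable X) : Tendsto (fun k : ℕ => X ^ k) atTop (𝓝 0) :=
  tendsto_zero_iff_norm_tendsto_zero.2 hX.summable_norm_pow.tendsto_atTop_zero

lemma stable_of_tendsto_pow (h : Tendsto (fun k : ℕ => X ^ k) atTop (𝓝 0)) : Stable X := by
  refine spectralRadius_lt_one_of_tendsto_pow ?_
  rw [tendsto_zero_iff_norm_tendsto_zero] at h ⊢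
  simpa only [← toComplex_pow, norm_toComplex] using h

lemma conj_pow_le {ρ : ℝ} (hρ : 0 ≤ ρ) (h : Xᵀ * S * X ≤ ρ • S) (k : ℕ) :
    (X ^ k)ᵀ * S * X ^ k ≤ ρ ^ k • S := by
  induction k with
  | zero => simp
  | succ k ih =>
    calc (X ^ (k + 1))ᵀ * S * X ^ (k + 1) = Xᵀ * ((X ^ k)ᵀ * S * X ^ k) * X := by
          rw [pow_succ, Matrix.transpose_mul]
          simp only [Matrix.mul_assoc]
      _ ≤ Xᵀ * (ρ ^ k • S) * X := conj_mono ih X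
      _ = ρ ^ k • (Xᵀ * S * X) := by rw [Matrix.mul_smul, Matrix.smul_mul]
      _ ≤ ρ ^ k • (ρ • S) := smul_le_smul_of_nonneg_left h (pow_nonneg hρ k)
      _ = ρ ^ (k + 1) • S := by rw [smul_smul, pow_succ]

lemma conj_le_one_sub_div_smul {b c : ℝ} (hb : 0 ≤ b) (hc : 0 ≤ c) (hS : S ≤ b • 1)
    (h : Xᵀ * S * X + c • 1 ≤ S) : Xᵀ * S * X ≤ (1 - c / b) • S := by
  have hcb : (c / b) • S ≤ c • 1 := by
    calc (c / b) • S ≤ (c / b * b) • 1 := by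
          simpa only [smul_smul] using smul_le_smul_of_nonneg_left hS (div_nonneg hc hb)
      _ ≤ c • 1 := by
          refine smul_le_smul_of_nonneg_right ?_ zero_le_one
          rcases hb.eq_or_lt with rfl | hb
          · rwa [mul_zero]
          · exact (div_mul_cancel₀ c hb.ne').le
  rw [sub_smul, one_smul]
  exact le_sub_iff_add_le.2 ((add_le_add_right hcb _).trans h)

lemma stable_of_lyapunov {c : ℝ} (hc : 0 < c) (hS : 0 ≤ S) (h : Xᵀ * S * X + c • 1 ≤ S) :
    Stable X := by
  set ρ := 1 - c / (‖S‖ + c)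
  have hb : 0 < ‖S‖ + c := by positivity
  have hρ0 : 0 ≤ ρ := sub_nonneg.2 ((div_le_one hb).2 (by linarith [norm_nonneg S]))
  have hρ1 : ρ < 1 := sub_lt_self 1 (by positivity)
  have hc1 : (0 : Matrix (Fin n) (Fin n) ℝ) ≤ c • 1 := smul_nonneg hc.le zero_le_one
  have hcS : c • 1 ≤ S := (le_add_of_nonneg_left (conj_nonneg hS X)).trans h
  have hcontr : Xᵀ * S * X ≤ ρ • S :=
    conj_le_one_sub_div_smul hb.le hc.le (le_smul_one_of_norm_le hS (by linarith)) h
  have hpow (k : ℕ) : ‖X ^ k‖ ^ 2 ≤ ρ ^ k * ‖S‖ / c := by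
    rw [le_div_iff₀' hc]
    calc c * ‖X ^ k‖ ^ 2 = ‖(X ^ k)ᵀ * (c • 1) * X ^ k‖ := by
          rw [Matrix.mul_smul, Matrix.mul_one, Matrix.smul_mul, norm_smul, norm_gram,
            Real.norm_of_nonneg hc.le]
      _ ≤ ‖ρ ^ k • S‖ := norm_le_norm_of_nonneg_of_le
          (conj_nonneg hc1 _) ((conj_mono hcS _).trans (conj_pow_le hρ0 hcontr k))
      _ = ρ ^ k * ‖S‖ := by rw [norm_smul, Real.norm_of_nonneg (pow_nonneg hρ0 k)]
  have hbound : Tendsto (fun k : ℕ => ρ ^ k * ‖S‖ / c) atTop (𝓝 0) := by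
    simpa using ((tendsto_pow_atTop_nhds_zero_of_lt_one hρ0 hρ1).mul_const ‖S‖).div_const c
  have hsq := squeeze_zero (fun k => sq_nonneg ‖X ^ k‖) hpow hbound
  refine stable_of_tendsto_pow (tendsto_zero_iff_norm_tendsto_zero.2 ?_)
  simpa using hsq.sqrt

lemma nonneg_of_conj_le (hX : Stable X) (hT : Xᵀ * T * X ≤ T) : 0 ≤ T := by
  have hlim : Tendsto (fun k : ℕ => (X ^ k)ᵀ * T * X ^ k) atTop (𝓝 (0ᵀ * T * 0)) := by
    have hpow := hX.tendsto_pow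
    have htr : Tendsto (fun k : ℕ => (X ^ k)ᵀ) atTop (𝓝 0ᵀ) :=
      (continuous_id.matrix_transpose.tendsto 0).comp hpow
    exact (htr.mul_const T).mul hpow
  rw [Matrix.mul_zero] at hlim
  exact le_of_tendsto' hlim fun k => by
    simpa using conj_pow_le zero_le_one (hT.trans_eq (one_smul ℝ T).symm) k

lemma Stable.exists_lyapunov_solution (hX : Stable X) (hY : 0 ≤ Y) :
    ∃ P, 0 ≤ P ∧ P = Xᵀ * P * X + Y := by
  set f : ℕ → Matrix (Fin n) (Fin n) ℝ := fun k => (X ^ k)ᵀ * Y * X ^ k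
  have hsucc (k : ℕ) : f (k + 1) = Xᵀ * f k * X := by
    simp only [f, pow_succ, Matrix.transpose_mul, Matrix.mul_assoc]
  have hf : Summable f := by
    refine .of_norm_bounded_eventually_nat (hX.summable_norm_pow.mul_left ‖Y‖) ?_
    filter_upwards [hX.summable_norm_pow.tendsto_atTop_zero.eventually_le_const one_pos] with k hk
    calc ‖f k‖ ≤ ‖X ^ k‖ * ‖Y‖ * ‖X ^ k‖ := norm_transpose_mul_mul_le _ _ _
      _ ≤ 1 * ‖Y‖ * ‖X ^ k‖ := by gcongr
      _ = ‖Y‖ * ‖X ^ k‖ := by rw [one_mul]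
  refine ⟨∑' k, f k, tsum_nonneg fun k => conj_nonneg hY _, ?_⟩
  calc ∑' k, f k = f 0 + ∑' k, f (k + 1) := hf.tsum_eq_zero_add
    _ = Xᵀ * (∑' k, f k) * X + Y := by
      have hf0 : f 0 = Y := by simp [f]
      rw [← hf.tsum_mul_left, ← (hf.mul_left _).tsum_mul_right, add_comm, hf0]
      simp only [hsucc]

lemma Stable.dlyap_nonneg_and_eq (hX : Stable X) (hY : 0 ≤ Y) :
    0 ≤ dlyap X Y ∧ dlyap X Y = Xᵀ * dlyap X Y * X + Y := by
  have hex : ∃ P : Matrix (Fin n) (Fin n) ℝ, P.PosSemidef ∧ P - Xᵀ * P * X = Y := by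
    obtain ⟨P, hP, hPeq⟩ := hX.exists_lyapunov_solution hY
    exact ⟨P, Matrix.nonneg_iff_posSemidef.1 hP, sub_eq_iff_eq_add'.2 hPeq⟩
  rw [dlyap, dif_pos hex]
  exact ⟨Matrix.nonneg_iff_posSemidef.2 hex.choose_spec.1,
    sub_eq_iff_eq_add'.1 hex.choose_spec.2⟩

end Stability

section FixedPoint

variable {α : Type*} [PartialOrder α] [TopologicalSpace α] [OrderClosedTopology α]

lemma isLUB_of_mapClusterPt {u : ℕ → α} {x : α} (hu : Monotone u)
    (hx : MapClusterPt x atTop u) : IsLUB (Set.range u) x := by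
  have hmem {s : Set α} (hs : IsClosed s) (h : ∀ᶠ k in atTop, u k ∈ s) : x ∈ s :=
    hs.closure_eq ▸ clusterPt_iff_forall_mem_closure.1 hx s h
  constructor
  · rintro _ ⟨k, rfl⟩
    exact hmem isClosed_Ici ((eventually_ge_atTop k).mono fun _ hj => hu hj)
  · exact fun b hb => hmem isClosed_Iic (.of_forall fun k => hb ⟨k, rfl⟩)

variable [CompactIccSpace α]

lemma exists_tendsto_of_monotone_of_mem_Icc {u : ℕ → α} {a b : α} (hu : Monotone u)
    (hmem : ∀ k, u k ∈ Set.Icc a b) : ∃ x ∈ Set.Icc a b, Tendsto u atTop (𝓝 x) := by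
  obtain ⟨x, hx, hxu⟩ :=
    isCompact_Icc.exists_mapClusterPt (tendsto_principal.2 (.of_forall (f := atTop) hmem))
  exact ⟨x, hx, isCompact_Icc.tendsto_nhds_of_unique_mapClusterPt (.of_forall hmem)
    fun y _ hyu => (isLUB_of_mapClusterPt hu hyu).unique (isLUB_of_mapClusterPt hu hxu)⟩

lemma exists_isFixedPt_mem_Icc {F : α → α} {a b : α} (hab : a ≤ b)
    (hmono : MonotoneOn F (Set.Icc a b)) (hcont : ∀ x ∈ Set.Icc a b, ContinuousAt F x)
    (ha : a ≤ F a) (hb : F b ≤ b) : ∃ x ∈ Set.Icc a b, Function.IsFixedPt F x := by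
  have hmaps : Set.MapsTo F (Set.Icc a b) (Set.Icc a b) := fun x hx =>
    ⟨ha.trans (hmono (Set.left_mem_Icc.2 hab) hx hx.1),
      (hmono hx (Set.right_mem_Icc.2 hab) hx.2).trans hb⟩
  have hmem (k : ℕ) : F^[k] a ∈ Set.Icc a b := hmaps.iterate k (Set.left_mem_Icc.2 hab)
  have hiter : Monotone fun k : ℕ => F^[k] a := monotone_nat_of_le_succ fun k => by
    induction k with
    | zero => exact ha
    | succ k ih =>
      simpa only [Function.iterate_succ_apply'] using hmono (hmem k) (hmem (k + 1)) ih
  obtain ⟨x, hx, hlim⟩ := exists_tendsto_of_monotone_of_mem_Icc hiter hmem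
  exact ⟨x, hx, isFixedPt_of_tendsto_iterate hlim (hcont x hx)⟩

end FixedPoint

instance {ι : Type*} [Finite ι] : CompactIccSpace (Matrix ι ι ℝ) where
  isCompact_Icc {S T} := by
    classical
    have := Fintype.ofFinite ι
    refine Metric.isCompact_of_isClosed_isBounded isClosed_Icc ?_
    refine (Metric.isBounded_closedBall (x := S) (r := ‖T - S‖)).subset fun P hP => ?_
    rw [mem_closedBall_iff_norm]
    exact norm_le_norm_of_nonneg_of_le (sub_nonneg.2 hP.1) (sub_le_sub_right hP.2 S)

section Riccati

variable {n m : ℕ} {Rx : Matrix (Fin n) (Fin n) ℝ} {Ru : Matrix (Fin m) (Fin m) ℝ}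
  {A P P' : Matrix (Fin n) (Fin n) ℝ} {B : Matrix (Fin n) (Fin m) ℝ}

/-- The right-hand side of the discrete algebraic Riccati equation, as an operator on value
matrices `P`. -/
def riccati (Rx : Matrix (Fin n) (Fin n) ℝ) (Ru : Matrix (Fin m) (Fin m) ℝ)
    (A : Matrix (Fin n) (Fin n) ℝ) (B : Matrix (Fin n) (Fin m) ℝ)
    (P : Matrix (Fin n) (Fin n) ℝ) : Matrix (Fin n) (Fin n) ℝ :=
  Aᵀ * P * A - Aᵀ * P * B * (Ru + Bᵀ * P * B)⁻¹ * Bᵀ * P * A + Rx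

/-- The feedback `K` that is greedy for the value matrix `P`: it minimizes the one-step cost
`policyCost Rx Ru A B P K`, and `Kinf` is its value at `P = Pinf`. -/
def riccatiGain (Ru : Matrix (Fin m) (Fin m) ℝ) (A : Matrix (Fin n) (Fin n) ℝ)
    (B : Matrix (Fin n) (Fin m) ℝ) (P : Matrix (Fin n) (Fin n) ℝ) : Matrix (Fin m) (Fin n) ℝ :=
  -((Ru + Bᵀ * P * B)⁻¹ * Bᵀ * P * A)

/-- The quadratic form of the cost of one step under the feedback `u = K x` followed by the
terminal cost `P`. -/
def policyCost (Rx : Matrix (Fin n) (Fin n) ℝ) (Ru : Matrix (Fin m) (Fin m) ℝ)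
    (A : Matrix (Fin n) (Fin n) ℝ) (B : Matrix (Fin n) (Fin m) ℝ)
    (P : Matrix (Fin n) (Fin n) ℝ) (K : Matrix (Fin m) (Fin n) ℝ) : Matrix (Fin n) (Fin n) ℝ :=
  (A + B * K)ᵀ * P * (A + B * K) + (Kᵀ * Ru * K + Rx)

lemma posDef_add_conj (hRu : Ru.PosDef) (hP : 0 ≤ P) : (Ru + Bᵀ * P * B).PosDef :=
  hRu.add_posSemidef (Matrix.nonneg_iff_posSemidef.1 (conj_nonneg hP B))

lemma add_conj_mul_riccatiGain (hRu : Ru.PosDef) (hP : 0 ≤ P) :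
    (Ru + Bᵀ * P * B) * riccatiGain Ru A B P = -(Bᵀ * P * A) := by
  have hinv := Matrix.mul_nonsing_inv_cancel_left _ (Bᵀ * P * A)
    ((Matrix.isUnit_iff_isUnit_det _).1 (posDef_add_conj (B := B) hRu hP).isUnit)
  rw [riccatiGain, Matrix.mul_neg, ← hinv]
  simp only [Matrix.mul_assoc]

lemma policyCost_eq_riccati_add (hRu : Ru.PosDef) (hP : 0 ≤ P) (K : Matrix (Fin m) (Fin n) ℝ) :
    policyCost Rx Ru A B P K = riccati Rx Ru A B P +
      (K - riccatiGain Ru A B P)ᵀ * (Ru + Bᵀ * P * B) * (K - riccatiGain Ru A B P) := by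
  have hG := add_conj_mul_riccatiGain (A := A) (B := B) hRu hP
  have hGt : (riccatiGain Ru A B P)ᵀ * (Ru + Bᵀ * P * B) = -(Aᵀ * P * B) := by
    have hsymm : (Ru + Bᵀ * P * B)ᵀ = Ru + Bᵀ * P * B :=
      isSymm_of_nonneg (posDef_add_conj hRu hP).posSemidef.nonneg
    have hGt := congrArg Matrix.transpose hG
    rw [Matrix.transpose_mul, hsymm] at hGt
    simpa only [Matrix.transpose_neg, Matrix.transpose_mul, Matrix.transpose_transpose,
      (isSymm_of_nonneg hP).eq, Matrix.mul_assoc] using hGt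
  have hriccati : riccati Rx Ru A B P =
      Aᵀ * P * A + Aᵀ * P * B * riccatiGain Ru A B P + Rx := by
    simp only [riccati, riccatiGain, Matrix.mul_neg, Matrix.mul_assoc, sub_eq_add_neg]
  rw [hriccati, Matrix.transpose_sub, Matrix.sub_mul, hGt, Matrix.mul_sub, Matrix.sub_mul,
    Matrix.sub_mul, Matrix.mul_assoc Kᵀ _ (riccatiGain Ru A B P), hG]
  simp only [policyCost, Matrix.transpose_add, Matrix.transpose_mul, Matrix.add_mul,
    Matrix.mul_add, Matrix.mul_assoc, Matrix.mul_neg, Matrix.neg_mul]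
  abel

lemma riccati_le_policyCost (hRu : Ru.PosDef) (hP : 0 ≤ P) (K : Matrix (Fin m) (Fin n) ℝ) :
    riccati Rx Ru A B P ≤ policyCost Rx Ru A B P K := by
  rw [policyCost_eq_riccati_add hRu hP]
  exact le_add_of_nonneg_right (conj_nonneg (posDef_add_conj hRu hP).posSemidef.nonneg _)

lemma riccati_eq_policyCost (hRu : Ru.PosDef) (hP : 0 ≤ P) :
    riccati Rx Ru A B P = policyCost Rx Ru A B P (riccatiGain Ru A B P) := by
  simp only [policyCost_eq_riccati_add hRu hP, sub_self, Matrix.mul_zero, add_zero]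

lemma policyCost_mono (h : P ≤ P') (K : Matrix (Fin m) (Fin n) ℝ) :
    policyCost Rx Ru A B P K ≤ policyCost Rx Ru A B P' K :=
  add_le_add_left (conj_mono h _) _

lemma riccati_mono (hRu : Ru.PosDef) (hP : 0 ≤ P) (h : P ≤ P') :
    riccati Rx Ru A B P ≤ riccati Rx Ru A B P' := by
  rw [riccati_eq_policyCost hRu (hP.trans h)]
  exact (riccati_le_policyCost hRu hP _).trans (policyCost_mono h _)

lemma continuousAt_riccati (hRu : Ru.PosDef) (hP : 0 ≤ P) :
    ContinuousAt (riccati Rx Ru A B) P := by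
  have hinv : ContinuousAt (fun S : Matrix (Fin n) (Fin n) ℝ => (Ru + Bᵀ * S * B)⁻¹) P := by
    simp only [Matrix.nonsing_inv_eq_ringInverse]
    obtain ⟨u, hu⟩ := (posDef_add_conj (B := B) hRu hP).isUnit
    have hu' := NormedRing.inverse_continuousAt u
    rw [hu] at hu'
    exact hu'.comp (f := fun S : Matrix (Fin n) (Fin n) ℝ => Ru + Bᵀ * S * B)
      (Continuous.continuousAt (by fun_prop))
  have hjoint : Continuous fun q : Matrix (Fin n) (Fin n) ℝ × Matrix (Fin m) (Fin m) ℝ =>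
      Aᵀ * q.1 * A - Aᵀ * q.1 * B * q.2 * Bᵀ * q.1 * A + Rx := by fun_prop
  exact hjoint.continuousAt.comp (f := fun S => (S, (Ru + Bᵀ * S * B)⁻¹))
    (continuousAt_id.prodMk hinv)

lemma exists_isDARESolution (hRx : 0 ≤ Rx) (hRu : Ru.PosDef) (h : Stabilizable A B) :
    ∃ P, IsDARESolution Rx Ru A B P := by
  obtain ⟨K, hK⟩ := h
  have hstage : 0 ≤ Kᵀ * Ru * K + Rx := add_nonneg (conj_nonneg hRu.posSemidef.nonneg K) hRx
  obtain ⟨W, hW, hWeq⟩ := hK.exists_lyapunov_solution hstage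
  obtain ⟨P, hP, hfix⟩ := exists_isFixedPt_mem_Icc (F := riccati Rx Ru A B) hW
    (fun P hP P' _ hPP' => riccati_mono hRu hP.1 hPP')
    (fun P hP => continuousAt_riccati hRu hP.1)
    (by simpa [riccati] using hRx)
    ((riccati_le_policyCost hRu hW K).trans hWeq.ge)
  exact ⟨P, Matrix.nonneg_iff_posSemidef.1 hP.1, hfix.symm⟩

lemma isDARESolution_pinf (hRx : 0 ≤ Rx) (hRu : Ru.PosDef) (h : Stabilizable A B) :
    IsDARESolution Rx Ru A B (Pinf Rx Ru A B) := by
  have hex := exists_isDARESolution hRx hRu h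
  rw [Pinf, dif_pos hex]
  exact hex.choose_spec

end Riccati

section ClosedLoop

variable {n m : ℕ} {Rx A P P' X E : Matrix (Fin n) (Fin n) ℝ} {Ru : Matrix (Fin m) (Fin m) ℝ}
  {B : Matrix (Fin n) (Fin m) ℝ} {s : ℝ}

lemma posDef_of_one_le (hRu : 1 ≤ Ru) : Ru.PosDef := by
  simpa using Matrix.PosDef.one.add_posSemidef (Matrix.nonneg_iff_posSemidef.1 (sub_nonneg.2 hRu))

lemma one_le_stageCost (hRu : 0 ≤ Ru) (hRx : 1 ≤ Rx) (K : Matrix (Fin m) (Fin n) ℝ) :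
    1 ≤ Kᵀ * Ru * K + Rx :=
  hRx.trans (le_add_of_nonneg_left (conj_nonneg hRu K))

lemma IsDARESolution.nonneg (h : IsDARESolution Rx Ru A B P) : 0 ≤ P :=
  Matrix.nonneg_iff_posSemidef.2 h.1

lemma IsDARESolution.eq_policyCost (h : IsDARESolution Rx Ru A B P) (hRu : Ru.PosDef) :
    P = policyCost Rx Ru A B P (riccatiGain Ru A B P) :=
  h.2.trans (riccati_eq_policyCost hRu h.nonneg)

lemma IsDARESolution.le_policyCost (h : IsDARESolution Rx Ru A B P) (hRu : Ru.PosDef)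
    (K : Matrix (Fin m) (Fin n) ℝ) : P ≤ policyCost Rx Ru A B P K :=
  h.2.le.trans (riccati_le_policyCost hRu h.nonneg K)

lemma IsDARESolution.lyapunov (h : IsDARESolution Rx Ru A B P) (hRu : Ru.PosDef) (hRx : 1 ≤ Rx) :
    (A + B * riccatiGain Ru A B P)ᵀ * P * (A + B * riccatiGain Ru A B P) + 1 ≤ P :=
  (add_le_add_right (one_le_stageCost hRu.posSemidef.nonneg hRx _) _).trans
    (h.eq_policyCost hRu).ge

lemma IsDARESolution.one_le (h : IsDARESolution Rx Ru A B P) (hRu : Ru.PosDef) (hRx : 1 ≤ Rx) :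
    1 ≤ P :=
  (le_add_of_nonneg_left (conj_nonneg h.nonneg _)).trans (h.lyapunov hRu hRx)

lemma IsDARESolution.stable (h : IsDARESolution Rx Ru A B P) (hRu : Ru.PosDef) (hRx : 1 ≤ Rx) :
    Stable (A + B * riccatiGain Ru A B P) :=
  stable_of_lyapunov one_pos h.nonneg (by simpa only [one_smul] using h.lyapunov hRu hRx)

lemma IsDARESolution.norm_gain_le (h : IsDARESolution Rx Ru A B P) (hRu : 1 ≤ Ru) (hRx : 0 ≤ Rx)
    (hs : 0 ≤ s) (hP : ‖P‖ ≤ s ^ 2) : ‖riccatiGain Ru A B P‖ ≤ s := by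
  set K := riccatiGain Ru A B P
  refine (norm_le_iff_gram_le hs).2 ?_
  calc Kᵀ * K ≤ Kᵀ * Ru * K := by simpa only [Matrix.mul_one] using conj_mono hRu K
    _ ≤ Kᵀ * Ru * K + Rx := le_add_of_nonneg_right hRx
    _ ≤ policyCost Rx Ru A B P K := le_add_of_nonneg_left (conj_nonneg h.nonneg _)
    _ = P := (h.eq_policyCost (posDef_of_one_le hRu)).symm
    _ ≤ s ^ 2 • 1 := le_smul_one_of_norm_le h.nonneg hP

lemma norm_le_of_lyapunov (h1 : 1 ≤ P) (h : Xᵀ * P * X + 1 ≤ P) (hs : 0 ≤ s)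
    (hP : ‖P‖ ≤ s ^ 2) : ‖X‖ ≤ s := by
  refine (norm_le_iff_gram_le hs).2 ?_
  calc Xᵀ * X ≤ Xᵀ * P * X := by simpa only [Matrix.mul_one] using conj_mono h1 X
    _ ≤ Xᵀ * P * X + 1 := le_add_of_nonneg_right zero_le_one
    _ ≤ P := h
    _ ≤ s ^ 2 • 1 := le_smul_one_of_norm_le (zero_le_one.trans h1) hP

lemma conj_add_le (hP : P.IsSymm) (X E : Matrix (Fin n) (Fin n) ℝ) :
    (X + E)ᵀ * P * (X + E) ≤ Xᵀ * P * X + (2 * ‖P‖ * ‖X‖ * ‖E‖ + ‖P‖ * ‖E‖ ^ 2) • 1 := by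
  set H := Xᵀ * P * E + Eᵀ * P * X + Eᵀ * P * E
  have hH : H.IsSymm := by
    simp only [H, Matrix.IsSymm, Matrix.transpose_add, Matrix.transpose_mul,
      Matrix.transpose_transpose, hP.eq, Matrix.mul_assoc]
    abel
  calc (X + E)ᵀ * P * (X + E) = Xᵀ * P * X + H := by
        simp only [H, Matrix.transpose_add, Matrix.add_mul, Matrix.mul_add]
        abel
    _ ≤ Xᵀ * P * X + ‖H‖ • 1 := add_le_add_right (le_norm_smul_one hH) _
    _ ≤ _ := by
      refine add_le_add_right (smul_le_smul_of_nonneg_right ?_ zero_le_one) _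
      linarith [norm_add₃_le (a := Xᵀ * P * E) (b := Eᵀ * P * X) (c := Eᵀ * P * E),
        norm_transpose_mul_mul_le X P E, norm_transpose_mul_mul_le E P X,
        norm_transpose_mul_mul_le E P E]

lemma IsDARESolution.smul_le_of_policy {t : ℝ} {K : Matrix (Fin m) (Fin n) ℝ}
    (h : IsDARESolution Rx Ru A B P) (hRu : Ru.PosDef) (hK : Stable (A + B * K)) (ht : 0 ≤ t)
    (hS : (A + B * K)ᵀ * P' * (A + B * K) + t • (Kᵀ * Ru * K + Rx) ≤ P') : t • P ≤ P' := by
  have hP := smul_le_smul_of_nonneg_left (h.le_policyCost hRu K) ht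
  rw [policyCost, smul_add] at hP
  refine sub_nonneg.1 (nonneg_of_conj_le hK ?_)
  rw [Matrix.mul_sub, Matrix.sub_mul, Matrix.mul_smul, Matrix.smul_mul]
  calc (A + B * K)ᵀ * P' * (A + B * K) - t • ((A + B * K)ᵀ * P * (A + B * K))
      ≤ P' - t • (Kᵀ * Ru * K + Rx) - (t • P - t • (Kᵀ * Ru * K + Rx)) :=
        sub_le_sub (le_sub_iff_add_le.2 hS) (sub_le_iff_le_add.2 hP)
    _ = P' - t • P := sub_sub_sub_cancel_right _ _ _

end ClosedLoop

section Perturbation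

variable {n m : ℕ} {Rx A A' P P' : Matrix (Fin n) (Fin n) ℝ} {Ru : Matrix (Fin m) (Fin m) ℝ}
  {B B' : Matrix (Fin n) (Fin m) ℝ} {s ε η : ℝ}

lemma norm_closedLoop_sub_le {K : Matrix (Fin m) (Fin n) ℝ} (hs : 1 ≤ s) (hK : ‖K‖ ≤ s)
    (hA : ‖A' - A‖ ≤ ε) (hB : ‖B' - B‖ ≤ ε) : ‖(A' + B' * K) - (A + B * K)‖ ≤ 2 * s * ε := by
  have hε : 0 ≤ ε := (norm_nonneg _).trans hA
  calc ‖(A' + B' * K) - (A + B * K)‖ = ‖(A' - A) + (B' - B) * K‖ := by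
        rw [Matrix.sub_mul, add_sub_add_comm]
    _ ≤ ‖A' - A‖ + ‖B' - B‖ * ‖K‖ :=
        (norm_add_le _ _).trans (add_le_add_right (Matrix.l2_opNorm_mul _ _) _)
    _ ≤ ε + ε * s := by gcongr
    _ ≤ 2 * s * ε := by nlinarith

lemma IsDARESolution.perturbed_lyapunov (h : IsDARESolution Rx Ru A B P) (hRu : 1 ≤ Ru)
    (hRx : 1 ≤ Rx) (hs : 1 ≤ s) (hP : ‖P‖ ≤ s ^ 2) (hA : ‖A' - A‖ ≤ ε) (hB : ‖B' - B‖ ≤ ε)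
    (hη : 4 * s ^ 4 * ε * (1 + ε) ≤ η) :
    (A' + B' * riccatiGain Ru A B P)ᵀ * P * (A' + B' * riccatiGain Ru A B P) +
      (1 - η) • ((riccatiGain Ru A B P)ᵀ * Ru * riccatiGain Ru A B P + Rx) ≤ P := by
  have hpd := posDef_of_one_le hRu
  have hε : 0 ≤ ε := (norm_nonneg _).trans hA
  have hs0 : 0 ≤ s := zero_le_one.trans hs
  have hη0 : 0 ≤ η := le_trans (by positivity) hη
  have hDARE := h.eq_policyCost hpd
  have hK := h.norm_gain_le hRu (zero_le_one.trans hRx) hs0 hP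
  have hX := norm_le_of_lyapunov (h.one_le hpd hRx) (h.lyapunov hpd hRx) hs0 hP
  have hE := norm_closedLoop_sub_le hs hK hA hB
  rw [policyCost] at hDARE
  set K := riccatiGain Ru A B P
  set Q := Kᵀ * Ru * K + Rx
  set X := A + B * K
  set E := (A' + B' * K) - X
  have hbound : 2 * ‖P‖ * ‖X‖ * ‖E‖ + ‖P‖ * ‖E‖ ^ 2 ≤ η := by
    calc _ ≤ 2 * s ^ 2 * s * (2 * s * ε) + s ^ 2 * (2 * s * ε) ^ 2 := by gcongr
      _ = 4 * s ^ 4 * ε * (1 + ε) := by ring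
      _ ≤ η := hη
  have hone : 1 ≤ Q := one_le_stageCost hpd.posSemidef.nonneg hRx K
  calc (A' + B' * K)ᵀ * P * (A' + B' * K) + (1 - η) • Q
      = (X + E)ᵀ * P * (X + E) + (1 - η) • Q := by rw [add_sub_cancel]
    _ ≤ Xᵀ * P * X + η • Q + (1 - η) • Q := by
        refine add_le_add_left ((conj_add_le (isSymm_of_nonneg h.nonneg) X E).trans
          (add_le_add_right ?_ _)) _
        exact (smul_le_smul_of_nonneg_right hbound zero_le_one).trans
          (smul_le_smul_of_nonneg_left hone hη0)
    _ = Xᵀ * P * X + Q := by module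
    _ = P := hDARE.symm

lemma IsDARESolution.stable_perturbed (h : IsDARESolution Rx Ru A B P) (hRu : 1 ≤ Ru)
    (hRx : 1 ≤ Rx) (hs : 1 ≤ s) (hP : ‖P‖ ≤ s ^ 2) (hA : ‖A' - A‖ ≤ ε) (hB : ‖B' - B‖ ≤ ε)
    (hη : 4 * s ^ 4 * ε * (1 + ε) ≤ η) (hη1 : η < 1) :
    Stable (A' + B' * riccatiGain Ru A B P) := by
  have hη' := sub_pos.2 hη1
  have hone := one_le_stageCost (posDef_of_one_le hRu).posSemidef.nonneg hRx
    (riccatiGain Ru A B P)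
  exact stable_of_lyapunov hη' h.nonneg <|
    (add_le_add_right (smul_le_smul_of_nonneg_left hone hη'.le) _).trans
      (h.perturbed_lyapunov hRu hRx hs hP hA hB hη)

lemma IsDARESolution.one_sub_smul_le (h : IsDARESolution Rx Ru A B P) (hRu : 1 ≤ Ru)
    (hRx : 1 ≤ Rx) (hs : 1 ≤ s) (hP : ‖P‖ ≤ s ^ 2) (hA : ‖A' - A‖ ≤ ε) (hB : ‖B' - B‖ ≤ ε)
    (hη : 4 * s ^ 4 * ε * (1 + ε) ≤ η) (hη1 : η < 1) (h' : IsDARESolution Rx Ru A' B' P') :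
    (1 - η) • P' ≤ P :=
  h'.smul_le_of_policy (posDef_of_one_le hRu)
    (h.stable_perturbed hRu hRx hs hP hA hB hη hη1) (sub_pos.2 hη1).le
    (h.perturbed_lyapunov hRu hRx hs hP hA hB hη)

lemma perturbation_margin (hs : 1 ≤ s) (hε : 0 ≤ ε) (hsε : 54 * s ^ 10 * ε ≤ 1) :
    4 * s ^ 4 * ε * (1 + ε) ≤ (13 * s ^ 6)⁻¹ := by
  have hε1 : ε ≤ 1 / 54 := by nlinarith [one_le_pow₀ hs (n := 10)]
  have hprod : s ^ 10 * ε * (1 + ε) ≤ 1 / 54 * (55 / 54) := by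
    gcongr <;> linarith
  rw [← one_div, le_div_iff₀ (by positivity)]
  nlinarith

lemma perturbation_margin_reverse (hs : 1 ≤ s) (hε : 0 ≤ ε) (hsε : 54 * s ^ 10 * ε ≤ 1) :
    4 * (21 / 20 * s) ^ 4 * ε * (1 + ε) ≤ (10 * s ^ 6)⁻¹ := by
  calc 4 * (21 / 20 * s) ^ 4 * ε * (1 + ε) = (21 / 20) ^ 4 * (4 * s ^ 4 * ε * (1 + ε)) := by ring
    _ ≤ (21 / 20) ^ 4 * (13 * s ^ 6)⁻¹ := by gcongr; exact perturbation_margin hs hε hsε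
    _ ≤ (10 * s ^ 6)⁻¹ := by
      rw [mul_inv, mul_inv, ← mul_assoc]
      gcongr
      norm_num

lemma inv_mul_pow_lt_one {c : ℝ} (hc : 1 < c) (hs : 1 ≤ s) (k : ℕ) : (c * s ^ k)⁻¹ < 1 :=
  inv_lt_one_of_one_lt₀ (one_lt_mul_of_lt_of_le hc (one_le_pow₀ hs))

lemma IsDARESolution.norm_perturbed_le (h : IsDARESolution Rx Ru A B P) (hRu : 1 ≤ Ru)
    (hRx : 1 ≤ Rx) (hs : 1 ≤ s) (hP : ‖P‖ ≤ s ^ 2) (hsε : 54 * s ^ 10 * ε ≤ 1)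
    (hA : ‖A' - A‖ ≤ ε) (hB : ‖B' - B‖ ≤ ε) (h' : IsDARESolution Rx Ru A' B' P') :
    ‖P'‖ ≤ 13 / 12 * s ^ 2 := by
  have hη : (13 * s ^ 6)⁻¹ ≤ 1 / 13 := by
    rw [← one_div]
    exact one_div_le_one_div_of_le (by norm_num) (by linarith [one_le_pow₀ hs (n := 6)])
  have hle := h.one_sub_smul_le hRu hRx hs hP hA hB
    (perturbation_margin hs ((norm_nonneg _).trans hA) hsε) (hη.trans_lt (by norm_num)) h'
  have hη0 : 0 ≤ 1 - (13 * s ^ 6)⁻¹ := by linarith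
  have hnorm := norm_le_norm_of_nonneg_of_le (smul_nonneg hη0 h'.nonneg) hle
  rw [norm_smul, Real.norm_of_nonneg hη0] at hnorm
  nlinarith [norm_nonneg P']

lemma IsDARESolution.norm_sub_le (h : IsDARESolution Rx Ru A B P) (hRu : 1 ≤ Ru)
    (hRx : 1 ≤ Rx) (hs : 1 ≤ s) (hP : ‖P‖ ≤ s ^ 2) (hsε : 54 * s ^ 10 * ε ≤ 1)
    (hA : ‖A' - A‖ ≤ ε) (hB : ‖B' - B‖ ≤ ε) (h' : IsDARESolution Rx Ru A' B' P') :
    ‖P - P'‖ ≤ (10 * s ^ 4)⁻¹ := by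
  have hs0 : 0 < s := one_pos.trans_le hs
  have hε : 0 ≤ ε := (norm_nonneg _).trans hA
  have hP' := h.norm_perturbed_le hRu hRx hs hP hsε hA hB h'
  have hforward := h.one_sub_smul_le hRu hRx hs hP hA hB (perturbation_margin hs hε hsε)
    (inv_mul_pow_lt_one (by norm_num) hs 6) h'
  have hreverse := h'.one_sub_smul_le hRu hRx (s := 21 / 20 * s) (by linarith)
    (hP'.trans (by nlinarith)) (by rwa [norm_sub_rev]) (by rwa [norm_sub_rev])
    (perturbation_margin_reverse hs hε hsε) (inv_mul_pow_lt_one (by norm_num) hs 6) h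
  refine norm_le_of_neg_le_of_le (by positivity) (neg_le.1 ?_) ?_
  · rw [neg_sub]
    refine (sub_le_smul_one_of_one_sub_smul_le (by positivity) h'.nonneg hP' hforward).trans
      (smul_le_smul_of_nonneg_right ?_ zero_le_one)
    field_simp
    norm_num
  · convert sub_le_smul_one_of_one_sub_smul_le (by positivity) h.nonneg hP hreverse using 2
    field_simp

lemma add_conj_mul_gain_sub (hRu : Ru.PosDef) (hP : 0 ≤ P) (hP' : 0 ≤ P') :
    (Ru + Bᵀ * P * B) * (riccatiGain Ru A' B' P' - riccatiGain Ru A B P) =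
      Bᵀ * (P * ((A + B * riccatiGain Ru A' B' P') - (A' + B' * riccatiGain Ru A' B' P')) +
        (P - P') * (A' + B' * riccatiGain Ru A' B' P')) +
      (B - B')ᵀ * P' * (A' + B' * riccatiGain Ru A' B' P') := by
  have hG' := add_conj_mul_riccatiGain (A := A') (B := B') hRu hP'
  set K' := riccatiGain Ru A' B' P'
  have hRuK' : Ru * K' = -(B'ᵀ * P' * (A' + B' * K')) := by
    rw [Matrix.add_mul, ← eq_sub_iff_add_eq] at hG'
    rw [hG', Matrix.mul_add, neg_add]
    simp only [Matrix.mul_assoc, sub_eq_add_neg]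
  rw [Matrix.mul_sub, add_conj_mul_riccatiGain hRu hP, Matrix.add_mul, hRuK']
  simp only [Matrix.mul_add, Matrix.sub_mul, Matrix.mul_sub, Matrix.transpose_sub,
    Matrix.mul_assoc]
  abel

lemma norm_mul_le_of_add_conj_mul_eq (hRu : 1 ≤ Ru) (hP : 1 ≤ P) {Δ : Matrix (Fin m) (Fin n) ℝ}
    {a : Matrix (Fin n) (Fin n) ℝ} {b : Matrix (Fin m) (Fin n) ℝ}
    (h : (Ru + Bᵀ * P * B) * Δ = Bᵀ * a + b) : ‖B * Δ‖ ≤ ‖a‖ + ‖b‖ := by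
  set G := B * Δ with hG
  have henergy : Gᵀ * G + Δᵀ * Δ ≤ Gᵀ * a + Δᵀ * b := by
    calc Gᵀ * G + Δᵀ * Δ ≤ Gᵀ * P * G + Δᵀ * Ru * Δ := by
          simpa only [Matrix.mul_one] using add_le_add (conj_mono hP G) (conj_mono hRu Δ)
      _ = Δᵀ * ((Ru + Bᵀ * P * B) * Δ) := by
          simp only [hG, Matrix.transpose_mul, Matrix.mul_add, Matrix.add_mul, Matrix.mul_assoc]
          abel
      _ = Gᵀ * a + Δᵀ * b := by
          rw [h, hG, Matrix.transpose_mul, Matrix.mul_add, Matrix.mul_assoc]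
  refine (norm_le_iff_gram_le (by positivity)).2 ?_
  calc Gᵀ * G ≤ Gᵀ * G + Δᵀ * Δ := le_add_of_nonneg_right (gram_nonneg Δ)
    _ ≤ aᵀ * a + bᵀ * b := gram_add_gram_le henergy
    _ ≤ ‖a‖ ^ 2 • 1 + ‖b‖ ^ 2 • 1 :=
        add_le_add ((norm_le_iff_gram_le (norm_nonneg a)).1 le_rfl)
          ((norm_le_iff_gram_le (norm_nonneg b)).1 le_rfl)
    _ ≤ (‖a‖ + ‖b‖) ^ 2 • 1 := by
        rw [← add_smul]
        refine smul_le_smul_of_nonneg_right ?_ zero_le_one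
        nlinarith [norm_nonneg a, norm_nonneg b]

lemma gain_margin (hs : 1 ≤ s) (hε : 0 ≤ ε) (hsε : 54 * s ^ 10 * ε ≤ 1) :
    s ^ 2 * (2 * (21 / 20 * s) * ε) + (10 * s ^ 4)⁻¹ * (21 / 20 * s) +
      ε * (13 / 12 * s ^ 2) * (21 / 20 * s) ≤ (5 * s ^ 3)⁻¹ := by
  have hs0 : 0 < s := one_pos.trans_le hs
  have hεs : ε * s ^ 3 ≤ 1 / 54 * (s ^ 3)⁻¹ := by
    rw [← div_eq_mul_inv, le_div_iff₀ (by positivity)]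
    nlinarith [pow_le_pow_right₀ hs (show 6 ≤ 10 by norm_num)]
  have hcancel : (10 * s ^ 4)⁻¹ * (21 / 20 * s) = 21 / 200 * (s ^ 3)⁻¹ := by
    field_simp
    norm_num
  rw [hcancel, mul_inv]
  nlinarith [inv_pos.2 (pow_pos hs0 3)]

lemma IsDARESolution.norm_mul_gain_sub_le (h : IsDARESolution Rx Ru A B P) (hRu : 1 ≤ Ru)
    (hRx : 1 ≤ Rx) (hs : 1 ≤ s) (hP : ‖P‖ ≤ s ^ 2) (hsε : 54 * s ^ 10 * ε ≤ 1)
    (hA : ‖A' - A‖ ≤ ε) (hB : ‖B' - B‖ ≤ ε) (h' : IsDARESolution Rx Ru A' B' P') :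
    ‖B * (riccatiGain Ru A' B' P' - riccatiGain Ru A B P)‖ ≤ (5 * s ^ 3)⁻¹ := by
  have hpd := posDef_of_one_le hRu
  have hs0 : 0 < s := one_pos.trans_le hs
  have hε : 0 ≤ ε := (norm_nonneg _).trans hA
  have hPn := h.norm_perturbed_le hRu hRx hs hP hsε hA hB h'
  have hPs : ‖P'‖ ≤ (21 / 20 * s) ^ 2 := hPn.trans (by nlinarith)
  have hPP := h.norm_sub_le hRu hRx hs hP hsε hA hB h'
  have hK := h'.norm_gain_le hRu (zero_le_one.trans hRx) (by positivity) hPs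
  have hY := norm_le_of_lyapunov (h'.one_le hpd hRx) (h'.lyapunov hpd hRx) (by positivity) hPs
  rw [norm_sub_rev] at hA hB
  have hE := norm_closedLoop_sub_le (by linarith) hK hA hB
  refine (norm_mul_le_of_add_conj_mul_eq hRu (h.one_le hpd hRx)
    (add_conj_mul_gain_sub hpd h.nonneg h'.nonneg)).trans ?_
  set Y := A' + B' * riccatiGain Ru A' B' P'
  set E := A + B * riccatiGain Ru A' B' P' - Y
  have ha : ‖P * E + (P - P') * Y‖ ≤
      s ^ 2 * (2 * (21 / 20 * s) * ε) + (10 * s ^ 4)⁻¹ * (21 / 20 * s) := by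
    calc _ ≤ ‖P‖ * ‖E‖ + ‖P - P'‖ * ‖Y‖ :=
          (norm_add_le _ _).trans (add_le_add (norm_mul_le _ _) (norm_mul_le _ _))
      _ ≤ _ := by gcongr
  have hb : ‖(B - B')ᵀ * P' * Y‖ ≤ ε * (13 / 12 * s ^ 2) * (21 / 20 * s) := by
    calc _ ≤ ‖B - B'‖ * ‖P'‖ * ‖Y‖ := norm_transpose_mul_mul_le _ _ _
      _ ≤ _ := by gcongr
  exact (add_le_add ha hb).trans (gain_margin hs hε hsε)

end Perturbation

section Resolvent

lemma norm_resolvent_add_le_two_mul {𝕜 𝔸 : Type*} [NormedField 𝕜] [NormedRing 𝔸]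
    [NormedAlgebra 𝕜 𝔸] {a b : 𝔸} {z : 𝕜} (ha : z ∈ resolventSet 𝕜 a)
    (hab : z ∈ resolventSet 𝕜 (a + b)) (hb : ‖resolvent a z‖ * ‖b‖ ≤ 1 / 2) :
    ‖resolvent (a + b) z‖ ≤ 2 * ‖resolvent a z‖ := by
  have hid : resolvent (a + b) z = resolvent a z + resolvent a z * b * resolvent (a + b) z := by
    have := spectrum.resolvent_sub_resolvent ha hab
    rwa [sub_add_cancel_left, mul_neg, neg_mul, sub_eq_iff_eq_add, eq_neg_add_iff_add_eq,
      add_comm, eq_comm] at this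
  have hstep : ‖resolvent (a + b) z‖ ≤ ‖resolvent a z‖ + 1 / 2 * ‖resolvent (a + b) z‖ := by
    calc ‖resolvent (a + b) z‖
        = ‖resolvent a z + resolvent a z * b * resolvent (a + b) z‖ := congrArg norm hid
      _ ≤ ‖resolvent a z‖ + ‖resolvent a z‖ * ‖b‖ * ‖resolvent (a + b) z‖ :=
          (norm_add_le _ _).trans (add_le_add_right (norm_mul₃_le) _)
      _ ≤ _ := by gcongr
  linarith

variable {𝔸 : Type*} [CStarAlgebra 𝔸] [PartialOrder 𝔸] [StarOrderedRing 𝔸] {d x : 𝔸} {z : ℂ}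

lemma norm_resolvent_le_two_mul_of_lyapunov (hd : 0 ≤ d) (h : star x * d * x + 1 ≤ d)
    (hz : ‖z‖ = 1) (hmem : z ∈ resolventSet ℂ x) : ‖resolvent x z‖ ≤ 2 * ‖d‖ := by
  set q := resolvent x z
  have hxq : x * q = z • q - 1 := by
    have hq : (z • 1 - x) * q = 1 := by
      rw [← Algebra.algebraMap_eq_smul_one]
      exact Ring.mul_inverse_cancel _ hmem
    rw [← hq, sub_mul, smul_mul_assoc, one_mul, sub_sub_cancel]
  have hexpand : star (x * q) * d * (x * q) =
      star q * d * q - (z • (d * q) + star z • (star q * d)) + d := by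
    have hzz : z * star z = 1 := by simpa [hz] using Complex.mul_conj' z
    rw [hxq]
    simp only [star_sub, star_smul, star_one, sub_mul, mul_sub, smul_mul_assoc, mul_smul_comm,
      one_mul, mul_one, smul_sub, smul_smul, hzz, one_smul]
    abel
  have hle : star q * q ≤ z • (d * q) + star z • (star q * d) := by
    have hconj : star (x * q) * d * (x * q) + star q * q ≤ star q * d * q := by
      simpa only [mul_add, add_mul, star_mul, mul_assoc, mul_one, one_mul] using
        star_left_conjugate_le_conjugate h q
    rw [hexpand, ← sub_nonneg] at hconj
    rw [← sub_nonneg]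
    refine (add_nonneg hconj hd).trans_eq ?_
    abel
  have hnorm : ‖q‖ * ‖q‖ ≤ 2 * ‖d‖ * ‖q‖ := by
    calc ‖q‖ * ‖q‖ = ‖star q * q‖ := CStarRing.norm_star_mul_self.symm
      _ ≤ ‖z • (d * q) + star z • (star q * d)‖ :=
          CStarAlgebra.norm_le_norm_of_nonneg_of_le (star_mul_self_nonneg q) hle
      _ ≤ ‖d * q‖ + ‖star q * d‖ := by
          simpa only [norm_smul, norm_star, hz, one_mul] using
            norm_add_le (z • (d * q)) (star z • (star q * d))
      _ ≤ ‖d‖ * ‖q‖ + ‖star q‖ * ‖d‖ := add_le_add (norm_mul_le _ _) (norm_mul_le _ _)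
      _ = 2 * ‖d‖ * ‖q‖ := by rw [norm_star]; ring
  rcases (norm_nonneg q).eq_or_lt with hq0 | hq0
  · rw [← hq0]; positivity
  · exact le_of_mul_le_mul_right hnorm hq0

end Resolvent

section Hinf

variable {n : ℕ} {X E D : Matrix (Fin n) (Fin n) ℝ} {z : ℂ} {c : ℝ}

lemma Stable.mem_resolventSet (hX : Stable X) (hz : ‖z‖ = 1) :
    z ∈ resolventSet ℂ (toComplex X) :=
  spectrum.mem_resolventSet_of_spectralRadius_lt <| by
    rwa [show ‖z‖₊ = 1 from NNReal.eq hz, ENNReal.coe_one]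

open scoped ComplexOrder in
lemma norm_resolvent_toComplex_le (hD : 0 ≤ D) (h : Xᵀ * D * X + 1 ≤ D) (hz : ‖z‖ = 1) :
    ‖resolvent (toComplex X) z‖ ≤ 2 * ‖D‖ := by
  have hX : Stable X := stable_of_lyapunov one_pos hD (by simpa only [one_smul] using h)
  have hDC : star (toComplex X) * toComplex D * toComplex X + 1 ≤ toComplex D := by
    rw [← sub_nonneg] at h ⊢
    convert toComplex_nonneg_iff.2 h using 1
    rw [Matrix.star_eq_conjTranspose, conjTranspose_toComplex]
    simp only [toComplex_eq_mapMatrix, map_sub, map_add, map_mul, map_one]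
  rw [← norm_toComplex D]
  exact norm_resolvent_le_two_mul_of_lyapunov (toComplex_nonneg_iff.2 hD) hDC hz
    (hX.mem_resolventSet hz)

lemma hinfNorm_eq_iSup_norm_resolvent (X : Matrix (Fin n) (Fin n) ℝ) :
    HinfNorm X = ⨆ z : Metric.sphere (0 : ℂ) 1, ‖resolvent (toComplex X) (z : ℂ)‖ := by
  simp only [HinfNorm, resolvent, Algebra.algebraMap_eq_smul_one, Matrix.nonsing_inv_eq_ringInverse]

lemma hinfNorm_le_of_norm_resolvent_le (h : ∀ z : ℂ, ‖z‖ = 1 → ‖resolvent (toComplex X) z‖ ≤ c) :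
    HinfNorm X ≤ c := by
  have : Nonempty (Metric.sphere (0 : ℂ) 1) := ⟨1, by simp⟩
  rw [hinfNorm_eq_iSup_norm_resolvent]
  exact ciSup_le fun z => h z (by simp)

lemma norm_resolvent_le_hinfNorm (h : ∀ z : ℂ, ‖z‖ = 1 → ‖resolvent (toComplex X) z‖ ≤ c)
    (hz : ‖z‖ = 1) : ‖resolvent (toComplex X) z‖ ≤ HinfNorm X := by
  rw [hinfNorm_eq_iSup_norm_resolvent]
  refine le_ciSup (f := fun z : Metric.sphere (0 : ℂ) 1 => ‖resolvent (toComplex X) (z : ℂ)‖)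
    ⟨c, ?_⟩ ⟨z, by simpa using hz⟩
  rintro _ ⟨w, rfl⟩
  exact h w (by simp)

lemma hinfNorm_add_le_two_mul (hX : Stable X) (hXE : Stable (X + E))
    (h : ∀ z : ℂ, ‖z‖ = 1 → ‖resolvent (toComplex X) z‖ ≤ c) (hE : c * ‖E‖ ≤ 1 / 2) :
    HinfNorm (X + E) ≤ 2 * HinfNorm X := by
  refine hinfNorm_le_of_norm_resolvent_le fun z hz => ?_
  have hadd : toComplex (X + E) = toComplex X + toComplex E := by
    simp only [toComplex_eq_mapMatrix, map_add]
  have hsmall : ‖resolvent (toComplex X) z‖ * ‖toComplex E‖ ≤ 1 / 2 := by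
    rw [norm_toComplex]
    exact (mul_le_mul_of_nonneg_right (h z hz) (norm_nonneg E)).trans hE
  calc ‖resolvent (toComplex (X + E)) z‖ ≤ 2 * ‖resolvent (toComplex X) z‖ := by
        rw [hadd]
        exact norm_resolvent_add_le_two_mul (hX.mem_resolventSet hz)
          (hadd ▸ hXE.mem_resolventSet hz) hsmall
    _ ≤ 2 * HinfNorm X := by gcongr; exact norm_resolvent_le_hinfNorm h hz

end Hinf

section CommonLyapunov

variable {n : ℕ} {X E P D Y : Matrix (Fin n) (Fin n) ℝ} {s : ℝ}

lemma Stable.le_dlyap (hX : Stable X) (hY : 0 ≤ Y) : Y ≤ dlyap X Y := by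
  obtain ⟨hD, hDeq⟩ := hX.dlyap_nonneg_and_eq hY
  exact (le_add_of_nonneg_left (conj_nonneg hD X)).trans hDeq.ge

lemma Stable.dlyap_le (hX : Stable X) (hY : 0 ≤ Y) (h : Xᵀ * P * X + Y ≤ P) : dlyap X Y ≤ P := by
  refine sub_nonneg.1 (nonneg_of_conj_le hX ?_)
  have hDeq := sub_eq_iff_eq_add.2 (hX.dlyap_nonneg_and_eq hY).2
  set D := dlyap X Y
  calc Xᵀ * (P - D) * X = Xᵀ * P * X - Xᵀ * D * X := by rw [Matrix.mul_sub, Matrix.sub_mul]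
    _ = Xᵀ * P * X + Y - D := by rw [← hDeq]; abel
    _ ≤ P - D := sub_le_sub_right h D

lemma Stable.one_le_dlyap (hX : Stable X) : 1 ≤ dlyap X 1 :=
  hX.le_dlyap zero_le_one

lemma Stable.dlyap_one_nonneg (hX : Stable X) : 0 ≤ dlyap X 1 :=
  (hX.dlyap_nonneg_and_eq zero_le_one).1

lemma Stable.conj_dlyap_add_one_le (hX : Stable X) : Xᵀ * dlyap X 1 * X + 1 ≤ dlyap X 1 :=
  (hX.dlyap_nonneg_and_eq zero_le_one).2.ge

lemma Stable.conj_add_dlyap_add_half_le (hX : Stable X) (hs : 1 ≤ s) (hDs : ‖dlyap X 1‖ ≤ s ^ 2)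
    (hE : ‖E‖ ≤ (5 * s ^ 3)⁻¹) :
    (X + E)ᵀ * dlyap X 1 * (X + E) + (1 / 2 : ℝ) • 1 ≤ dlyap X 1 := by
  have hXs := norm_le_of_lyapunov hX.one_le_dlyap hX.conj_dlyap_add_one_le (by linarith) hDs
  have hD := hX.dlyap_one_nonneg
  have hlyap := hX.conj_dlyap_add_one_le
  set D := dlyap X 1
  have hbound : 2 * ‖D‖ * ‖X‖ * ‖E‖ + ‖D‖ * ‖E‖ ^ 2 ≤ 1 / 2 := by
    calc _ ≤ 2 * s ^ 2 * s * (5 * s ^ 3)⁻¹ + s ^ 2 * (5 * s ^ 3)⁻¹ ^ 2 := by gcongr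
      _ = 2 / 5 + 1 / 25 * (s ^ 4)⁻¹ := by field_simp; ring
      _ ≤ 1 / 2 := by linarith [inv_le_one_of_one_le₀ (one_le_pow₀ hs (n := 4))]
  calc (X + E)ᵀ * D * (X + E) + (1 / 2 : ℝ) • 1
      ≤ Xᵀ * D * X + (1 / 2 : ℝ) • 1 + (1 / 2 : ℝ) • 1 :=
        add_le_add_left ((conj_add_le (isSymm_of_nonneg hD) X E).trans
          (add_le_add_right (smul_le_smul_of_nonneg_right hbound zero_le_one) _)) _
    _ = Xᵀ * D * X + 1 := by module
    _ ≤ D := hlyap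

lemma Stable.add_of_norm_le (hX : Stable X) (hs : 1 ≤ s) (hDs : ‖dlyap X 1‖ ≤ s ^ 2)
    (hE : ‖E‖ ≤ (5 * s ^ 3)⁻¹) : Stable (X + E) :=
  stable_of_lyapunov one_half_pos hX.dlyap_one_nonneg (hX.conj_add_dlyap_add_half_le hs hDs hE)

lemma Stable.conj_add_dlyap_le (hX : Stable X) (hs : 1 ≤ s) (hDs : ‖dlyap X 1‖ ≤ s ^ 2)
    (hE : ‖E‖ ≤ (5 * s ^ 3)⁻¹) :
    (X + E)ᵀ * dlyap X 1 * (X + E) ≤ (1 - 1 / 2 * ‖dlyap X 1‖⁻¹) • dlyap X 1 :=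
  conj_le_one_sub_div_smul (norm_nonneg _) one_half_pos.le
    (le_norm_smul_one (isSymm_of_nonneg hX.dlyap_one_nonneg))
    (hX.conj_add_dlyap_add_half_le hs hDs hE)

lemma Stable.hinfNorm_add_le (hX : Stable X) (hs : 1 ≤ s) (hDs : ‖dlyap X 1‖ ≤ s ^ 2)
    (hE : ‖E‖ ≤ (5 * s ^ 3)⁻¹) : HinfNorm (X + E) ≤ 2 * HinfNorm X := by
  refine hinfNorm_add_le_two_mul hX (hX.add_of_norm_le hs hDs hE)
    (fun z => norm_resolvent_toComplex_le hX.dlyap_one_nonneg hX.conj_dlyap_add_one_le) ?_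
  calc 2 * ‖dlyap X 1‖ * ‖E‖ ≤ 2 * s ^ 2 * (5 * s ^ 3)⁻¹ := by gcongr
    _ = 2 / 5 * s⁻¹ := by field_simp
    _ ≤ 1 / 2 := by linarith [inv_le_one_of_one_le₀ hs]

lemma Stable.hinfNorm_le (hX : Stable X) : HinfNorm X ≤ 2 * ‖dlyap X 1‖ ^ (3 / 2 : ℝ) := by
  have hpow : ‖dlyap X 1‖ ≤ ‖dlyap X 1‖ ^ (3 / 2 : ℝ) := by
    rcases eq_zero_or_one_le_norm hX.one_le_dlyap with h0 | h1
    · simp [h0]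
    · exact Real.self_le_rpow_of_one_le h1 (by norm_num)
  calc HinfNorm X ≤ 2 * ‖dlyap X 1‖ := hinfNorm_le_of_norm_resolvent_le fun z =>
        norm_resolvent_toComplex_le hX.dlyap_one_nonneg hX.conj_dlyap_add_one_le
    _ ≤ 2 * ‖dlyap X 1‖ ^ (3 / 2 : ℝ) := by gcongr

lemma one_sub_half_inv_norm_smul_mono (hD : 1 ≤ D) (hDP : D ≤ P) :
    (1 - 1 / 2 * ‖D‖⁻¹) • D ≤ (1 - 1 / 2 * ‖P‖⁻¹) • D := by
  have hD0 := zero_le_one.trans hD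
  rcases eq_zero_or_one_le_norm hD with rfl | h1
  · simp only [smul_zero, le_refl]
  · have hinv := inv_anti₀ (one_pos.trans_le h1) (norm_le_norm_of_nonneg_of_le hD0 hDP)
    exact smul_le_smul_of_nonneg_right (by linarith) hD0

/- The case `P = 0`, which forces `n = 0`, is covered with `s = 1` because `1 / 0 = 0`. -/
lemma exists_norm_le_sq (h : 1 ≤ P) :
    ∃ s : ℝ, 1 ≤ s ∧ ‖P‖ ≤ s ^ 2 ∧ 54 * s ^ 10 * (1 / (54 * ‖P‖ ^ 5)) ≤ 1 := by
  rcases eq_zero_or_one_le_norm h with rfl | h1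
  · exact ⟨1, le_rfl, by simp, by simp⟩
  · have hsq := Real.sq_sqrt (norm_nonneg P)
    refine ⟨√‖P‖, Real.one_le_sqrt.2 h1, hsq.ge, le_of_eq ?_⟩
    rw [show √‖P‖ ^ 10 = ‖P‖ ^ 5 by rw [← congrArg (· ^ 5) hsq, ← pow_mul]]
    field_simp

end CommonLyapunov

end LQR

end

theorem mainTheorem7_general {n m : ℕ}
    (Rx : Matrix (Fin n) (Fin n) ℝ) (Ru : Matrix (Fin m) (Fin m) ℝ)
    (hRx : 1 ≤ Rx) (hRu : 1 ≤ Ru)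
    (A Ahat : Matrix (Fin n) (Fin n) ℝ) (B Bhat : Matrix (Fin n) (Fin m) ℝ)
    (hstab : LQR.Stabilizable A B)
    (hclose : max ‖Ahat - A‖ ‖Bhat - B‖ ≤ 1 / LQR.Csafe Rx Ru A B)
    (P D Acl AclHat : Matrix (Fin n) (Fin n) ℝ)
    (hP : P = LQR.Pinf Rx Ru A B)
    (hAcl : Acl = A + B * LQR.Kinf Rx Ru A B)
    (hAclHat : AclHat = A + B * LQR.Kinf Rx Ru Ahat Bhat)
    (hD : D = LQR.dlyap Acl 1) :
    (LQR.Stabilizable Ahat Bhat ∧ LQR.Stable Acl ∧ LQR.Stable AclHat) ∧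
    (1 ≤ D ∧ D ≤ P) ∧
    (LQR.HinfNorm AclHat ≤ 2 * LQR.HinfNorm Acl ∧
      2 * LQR.HinfNorm Acl ≤ 4 * ‖D‖ ^ (3 / 2 : ℝ) ∧
      4 * ‖D‖ ^ (3 / 2 : ℝ) ≤ 4 * ‖P‖ ^ (3 / 2 : ℝ)) ∧
    (AclHatᵀ * D * AclHat ≤ (1 - 1 / 2 * ‖D‖⁻¹) • D ∧
      (1 - 1 / 2 * ‖D‖⁻¹) • D ≤ (1 - 1 / 2 * ‖P‖⁻¹) • D) := by
  open LQR in
  have hpd := posDef_of_one_le hRu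
  have h := isDARESolution_pinf (zero_le_one.trans hRx) hpd hstab
  obtain ⟨s, hs, hPs, hsε⟩ := exists_norm_le_sq (h.one_le hpd hRx)
  obtain ⟨hA, hB⟩ := max_le_iff.1 hclose
  have hstab' : Stabilizable Ahat Bhat := ⟨_, h.stable_perturbed hRu hRx hs hPs hA hB
    (perturbation_margin hs ((norm_nonneg _).trans hA) hsε)
    (inv_mul_pow_lt_one (by norm_num) hs 6)⟩
  have h' := isDARESolution_pinf (zero_le_one.trans hRx) hpd hstab'
  have hE := h.norm_mul_gain_sub_le hRu hRx hs hPs hsε hA hB h'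
  obtain rfl : AclHat = Acl + B * (Kinf Rx Ru Ahat Bhat - Kinf Rx Ru A B) := by
    rw [hAclHat, hAcl, Matrix.mul_sub, add_assoc, add_sub_cancel]
  subst hP hAcl hD
  have hX : Stable (A + B * Kinf Rx Ru A B) := h.stable hpd hRx
  have hDP := hX.dlyap_le zero_le_one (h.lyapunov hpd hRx)
  have hDPn := norm_le_norm_of_nonneg_of_le hX.dlyap_one_nonneg hDP
  have hDs := hDPn.trans hPs
  refine ⟨⟨hstab', hX, hX.add_of_norm_le hs hDs hE⟩, ⟨hX.one_le_dlyap, hDP⟩,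
    ⟨hX.hinfNorm_add_le hs hDs hE, ?_, by gcongr⟩,
    hX.conj_add_dlyap_le hs hDs hE, one_sub_half_inv_norm_smul_mono hX.one_le_dlyap hDP⟩
  linarith [hX.hinfNorm_le]

theorem mainTheorem7 (n m : ℕ)
    (Rx : Matrix (Fin n) (Fin n) ℝ) (Ru : Matrix (Fin m) (Fin m) ℝ)
    (hRx : 1 ≤ Rx) (hRu : Ru = 1)
    (A Ahat : Matrix (Fin n) (Fin n) ℝ) (B Bhat : Matrix (Fin n) (Fin m) ℝ)
    (hstab : LQR.Stabilizable A B)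
    (hclose : max ‖Ahat - A‖ ‖Bhat - B‖ ≤ 1 / LQR.Csafe Rx Ru A B)
    (P D Acl AclHat : Matrix (Fin n) (Fin n) ℝ)
    (hP : P = LQR.Pinf Rx Ru A B)
    (hAcl : Acl = A + B * LQR.Kinf Rx Ru A B)
    (hAclHat : AclHat = A + B * LQR.Kinf Rx Ru Ahat Bhat)
    (hD : D = LQR.dlyap Acl 1) :
    -- all the objects in the claim are well defined
    (LQR.Stabilizable Ahat Bhat ∧ LQR.Stable Acl ∧ LQR.Stable AclHat) ∧
    -- the Lyapunov matrix lies between the identity and the value matrix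
    (1 ≤ D ∧ D ≤ P) ∧
    -- the closed loops have bounded norm
    (LQR.HinfNorm AclHat ≤ 2 * LQR.HinfNorm Acl ∧
      2 * LQR.HinfNorm Acl ≤ 4 * ‖D‖ ^ (3 / 2 : ℝ) ∧
      4 * ‖D‖ ^ (3 / 2 : ℝ) ≤ 4 * ‖P‖ ^ (3 / 2 : ℝ)) ∧
    -- the Lyapunov matrix is common to all the perturbed closed loops
    (AclHatᵀ * D * AclHat ≤ (1 - 1 / 2 * ‖D‖⁻¹) • D ∧
      (1 - 1 / 2 * ‖D‖⁻¹) • D ≤ (1 - 1 / 2 * ‖P‖⁻¹) • D) :=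
  mainTheorem7_general Rx Ru hRx hRu.ge A Ahat B Bhat hstab hclose P D Acl AclHat
    hP hAcl hAclHat hD
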